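/- Let $A$ and $B$ be finite-dimensional quantum systems and let $\mathcal N$ be a quantum channel (a completely positive trace-preserving linear map) from $A$ to $B$. A complementary channel of $\mathcal N$ is a map $\mathcal N^c(X)=\mathrm{Tr}_B(VXV^\dagger)$ from $A$ to a finite-dimensional system $E$, where $V:A\to B\otimes E$ is an isometry with $\mathcal N(X)=\mathrm{Tr}_E(VXV^\dagger)$ for all $X$. The channel $\mathcal N$ is degradable if it has a complementary channel of the form $\mathcal D\circ\mathcal N$ with $\mathcal D$ a quantum channel. For a finite ensemble $\{p_i,\sigma_i\}$ of density matrices let $\chi(\{p_i,\sigma_i\})=S(\sum_i p_i\sigma_i)-\sum_i p_iS(\sigma_i)$, where $S(\sigma)=-\mathrm{Tr}(\sigma\log\sigma)$. Let $\mathcal N$ be degradable, let $\mathcal N^c$ be any complementary channel of $\mathcal N$, and fix finitely many density matrices $\rho_i$ on $A$. Then $$\mathcal X_P(\{p_i,\rho_i\})=\chi_{AB}-\chi_{AE}=\chi(\{p_i,\mathcal N(\rho_i)\})-\chi(\{p_i,\mathcal N^c(\rho_i)\})$$ is a concave function of the probability vector $p=(p_i)$: for all probability vectors $p^1,p^2$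 and all $\alpha_1,\alpha_2\ge 0$ with $\alpha_1+\alpha_2=1$, $$\mathcal X_P(\{\alpha_1p^1_i+\alpha_2p^2_i,\rho_i\})\ \ge\ \alpha_1\,\mathcal X_P(\{p^1_i,\rho_i\})+\alpha_2\,\mathcal X_P(\{p^2_i,\rho_i\}).$$ -/

import Mathlib

open scoped ComplexOrder

namespace QChannel

/-- A density matrix: positive semidefinite with unit trace. -/
structure IsDensity {A : Type*} [Fintype A] (ρ : Matrix A A ℂ) : Prop where
  posSemidef : ρ.PosSemidef
  trace_eq_one : ρ.trace = 1

/-- The von Neumann entropy `S(ρ) = -Tr (ρ log ρ) = -∑ λ log λ`, the sum running over the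
eigenvalues `λ` of the Hermitian matrix `ρ` with multiplicity (natural logarithm, `0 log 0 = 0`).
Matrices that are not Hermitian get the value `0`; they never occur. -/
noncomputable def entropy {A : Type*} [Fintype A] [DecidableEq A] (ρ : Matrix A A ℂ) : ℝ :=
  open Classical in
  if h : ρ.IsHermitian then ∑ a, Real.negMulLog (h.eigenvalues a) else 0

/-- `N ⊗ id` acting on matrices over `A ⊗ R`, blockwise. -/
def ampliation {A B : Type*} (R : Type*)
    (N : Matrix A A ℂ →ₗ[ℂ] Matrix B B ℂ) (X : Matrix (A × R) (A × R) ℂ) :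
    Matrix (B × R) (B × R) ℂ :=
  Matrix.of fun x y => N (Matrix.of fun a a' => X (a, x.2) (a', y.2)) x.1 y.1

/-- A quantum channel: a completely positive trace-preserving linear map. -/
structure IsChannel {A B : Type*} [Fintype A] [Fintype B]
    (N : Matrix A A ℂ →ₗ[ℂ] Matrix B B ℂ) : Prop where
  completelyPositive : ∀ (k : ℕ) (X : Matrix (A × Fin k) (A × Fin k) ℂ),
    X.PosSemidef → (ampliation (Fin k) N X).PosSemidef
  tracePreserving : ∀ X : Matrix A A ℂ, (N X).trace = X.trace

/-- The partial trace over the second factor (the environment `E`). -/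
def traceRight {B E : Type*} [Fintype E] (X : Matrix (B × E) (B × E) ℂ) : Matrix B B ℂ :=
  Matrix.of fun b b' => ∑ e, X (b, e) (b', e)

/-- The partial trace over the first factor (the output system `B`). -/
def traceLeft {B E : Type*} [Fintype B] (X : Matrix (B × E) (B × E) ℂ) : Matrix E E ℂ :=
  Matrix.of fun e e' => ∑ b, X (b, e) (b, e')

open scoped Matrix in
/-- `Nc` is a complementary channel of `N`: for some isometry `V : A → B ⊗ E` one has
`N ρ = Tr_E (V ρ V†)` and `Nc ρ = Tr_B (V ρ V†)`. -/
def IsComplementary {A B E : Type*} [Fintype A] [DecidableEq A] [Fintype B] [Fintype E]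
    (N : Matrix A A ℂ →ₗ[ℂ] Matrix B B ℂ) (Nc : Matrix A A ℂ →ₗ[ℂ] Matrix E E ℂ) : Prop :=
  ∃ V : Matrix (B × E) A ℂ, Vᴴ * V = 1 ∧
    (∀ X, N X = traceRight (V * X * Vᴴ)) ∧ (∀ X, Nc X = traceLeft (V * X * Vᴴ))

/-- `N` is degradable: it has a complementary channel `Nc` (with some finite-dimensional
environment) of the form `Nc = D ∘ N` for a quantum channel `D`. -/
def IsDegradable {A B : Type*} [Fintype A] [DecidableEq A] [Fintype B]
    (N : Matrix A A ℂ →ₗ[ℂ] Matrix B B ℂ) : Prop :=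
  ∃ (k : ℕ) (Nc : Matrix A A ℂ →ₗ[ℂ] Matrix (Fin k) (Fin k) ℂ)
    (D : Matrix B B ℂ →ₗ[ℂ] Matrix (Fin k) (Fin k) ℂ),
    IsComplementary N Nc ∧ IsChannel D ∧ Nc = D ∘ₗ N

/-- The Holevo quantity `χ = S(∑ pᵢ ρᵢ) - ∑ pᵢ S(ρᵢ)` of an ensemble `{pᵢ, ρᵢ}`. -/
noncomputable def holevo {ι A : Type*} [Fintype ι] [Fintype A] [DecidableEq A]
    (p : ι → ℝ) (ρ : ι → Matrix A A ℂ) : ℝ :=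
  entropy (∑ i, (p i : ℂ) • ρ i) - ∑ i, p i * entropy (ρ i)

/-- The private Holevo difference `χ_AB - χ_AE` of the input ensemble `{pᵢ, ρᵢ}`: the Holevo
quantity of the ensemble `{pᵢ, N ρᵢ}` minus that of the ensemble `{pᵢ, Nc ρᵢ}`. -/
noncomputable def privateHolevo {ι A B E : Type*} [Fintype ι]
    [Fintype B] [DecidableEq B] [Fintype E] [DecidableEq E]
    (N : Matrix A A ℂ →ₗ[ℂ] Matrix B B ℂ) (Nc : Matrix A A ℂ →ₗ[ℂ] Matrix E E ℂ)
    (p : ι → ℝ) (ρ : ι → Matrix A A ℂ) : ℝ :=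
  holevo p (fun i => N (ρ i)) - holevo p (fun i => Nc (ρ i))

end QChannel

/-! Subtracting the Holevo quantities leaves S(N(∑ pᵢρᵢ)) - S(Nc(∑ pᵢρᵢ)) plus a function linear in
`p`. All complementary channels have equal output entropies, so `Nc` may be replaced by D ∘ N.
Concavity then says that the two-member Holevo quantity of the outputs of `N` does not increase
under `D`. That quantity is an average of relative entropies to the mixture, so monotonicity of
relative entropy suffices. Here `logPotential` runs from Tr(ρ log σ) at t = 0 to -S(ρ) at infinity
(after removing Tr ρ · log t), with derivative Tr(ρ (L_σ + t R_ρ)⁻¹ ρ). This derivative is a maximum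
of quadratic forms, and the Schwarz inequality for the adjoint of a channel shows that it decreases
under channels (`IsChannel.resolvent_le`). Comparing the two endpoints gives monotonicity. -/

namespace QChannel

open scoped Matrix

/-! ### Entropy via characteristic polynomials; complementary channels -/

section Entropy

theorem entropy_eq_sum_roots {A : Type*} [Fintype A] [DecidableEq A] {ρ : Matrix A A ℂ}
    (h : ρ.IsHermitian) :
    entropy ρ = (ρ.charpoly.roots.map fun z : ℂ => Real.negMulLog z.re).sum := by
  rw [entropy, dif_pos h, h.roots_charpoly_eq_eigenvalues, Multiset.map_map]
  simp [Function.comp_def]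

/-- Zero roots contribute 0 log 0 = 0. Hence PQ and QP can be compared even when their sizes differ,
their characteristic polynomials agreeing up to powers of X. -/
theorem sum_negMulLog_roots_X_pow_mul (n : ℕ) {p : Polynomial ℂ} (hp : p ≠ 0) :
    ((Polynomial.X ^ n * p).roots.map fun z : ℂ => Real.negMulLog z.re).sum =
      (p.roots.map fun z : ℂ => Real.negMulLog z.re).sum := by
  rw [Polynomial.roots_mul (mul_ne_zero (pow_ne_zero _ Polynomial.X_ne_zero) hp)]
  simp [Multiset.map_nsmul, Multiset.sum_nsmul]

/-- The entropy of a product only depends on the product in the other order. -/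
theorem entropy_mul_eq_sum_roots {C E : Type*} [Fintype C] [DecidableEq C] [Fintype E]
    [DecidableEq E] (P : Matrix E C ℂ) (Q : Matrix C E ℂ) (h : (P * Q).IsHermitian) :
    entropy (P * Q) = ((Q * P).charpoly.roots.map fun z : ℂ => Real.negMulLog z.re).sum := by
  rw [entropy_eq_sum_roots h,
    ← sum_negMulLog_roots_X_pow_mul (Fintype.card C) (Matrix.charpoly_monic _).ne_zero,
    Matrix.charpoly_mul_comm', sum_negMulLog_roots_X_pow_mul _ (Matrix.charpoly_monic _).ne_zero]

/-- The isometry `V : A → B ⊗ E` regarded as a map `B ⊗ A → E`. -/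
def reshape {A B E : Type*} (V : Matrix (B × E) A ℂ) : Matrix E (B × A) ℂ :=
  Matrix.of fun e x => V (x.1, e) x.2

/-- With R the reshaped isometry, the output is R(1 ⊗ X)Rᴴ. Its nonzero spectrum is that of (1 ⊗
X)RᴴR, which sees the isometry only through RᴴR. -/
theorem traceLeft_conj_eq_reshape {A B E : Type*} [Fintype A] [Fintype B] [DecidableEq B]
    (V : Matrix (B × E) A ℂ) (X : Matrix A A ℂ) :
    traceLeft (V * X * Vᴴ) =
      reshape V * (Matrix.kroneckerMap (· * ·) (1 : Matrix B B ℂ) X * (reshape V)ᴴ) := by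
  ext e e'
  simp only [traceLeft, reshape, Matrix.of_apply, Matrix.mul_apply, Matrix.conjTranspose_apply,
    Matrix.kroneckerMap_apply, Fintype.sum_prod_type, Matrix.one_apply, ite_mul, one_mul, zero_mul]
  refine Finset.sum_congr rfl fun b _ => ?_
  simp only [Finset.sum_mul, Finset.mul_sum]
  rw [Finset.sum_comm]
  refine Finset.sum_congr rfl fun a _ => ?_
  rw [Finset.sum_comm' (t' := Finset.univ) (s' := fun _ => Finset.univ) (by simp)]
  simp [mul_assoc]

theorem reshape_gram_eq {A B E F : Type*} [Fintype A] [DecidableEq A] [Fintype E] [Fintype F]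
    (V : Matrix (B × E) A ℂ) (W : Matrix (B × F) A ℂ)
    (h : ∀ X : Matrix A A ℂ, traceRight (V * X * Vᴴ) = traceRight (W * X * Wᴴ)) :
    (reshape V)ᴴ * reshape V = (reshape W)ᴴ * reshape W := by
  ext ⟨b, a⟩ ⟨b', a'⟩
  -- The entries of RᴴR are exactly the entries of the channel outputs on matrix units.
  have := congrFun (congrFun (h (Matrix.single a' a 1)) b') b
  simpa [traceRight, reshape, Matrix.mul_apply, Matrix.single_apply, Finset.sum_ite_eq, ite_and,
    mul_comm] using this

theorem isHermitian_traceLeft_conj {A B E : Type*} [Fintype A] [Fintype B]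
    (V : Matrix (B × E) A ℂ) {X : Matrix A A ℂ} (hX : X.IsHermitian) :
    (traceLeft (V * X * Vᴴ)).IsHermitian := by
  have := Matrix.isHermitian_mul_mul_conjTranspose V hX
  ext e e'
  simp only [traceLeft, Matrix.conjTranspose_apply, Matrix.of_apply, star_sum]
  exact Finset.sum_congr rfl fun b _ => this.apply _ _

/-- All complementary channels of a channel have the same output entropies. -/
theorem IsComplementary.entropy_eq {A B E F : Type*} [Fintype A] [DecidableEq A] [Fintype B]
    [DecidableEq B] [Fintype E] [DecidableEq E] [Fintype F] [DecidableEq F]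
    {N : Matrix A A ℂ →ₗ[ℂ] Matrix B B ℂ} {M : Matrix A A ℂ →ₗ[ℂ] Matrix E E ℂ}
    {M' : Matrix A A ℂ →ₗ[ℂ] Matrix F F ℂ} (h : IsComplementary N M) (h' : IsComplementary N M')
    {X : Matrix A A ℂ} (hX : X.IsHermitian) : entropy (M X) = entropy (M' X) := by
  obtain ⟨V, -, hV, hM⟩ := h
  obtain ⟨W, -, hW, hM'⟩ := h'
  have hg := reshape_gram_eq V W fun X => by rw [← hV, ← hW]
  have h1 := isHermitian_traceLeft_conj V hX
  have h2 := isHermitian_traceLeft_conj W hX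
  rw [hM, hM']
  rw [traceLeft_conj_eq_reshape] at h1 h2 ⊢
  rw [traceLeft_conj_eq_reshape, entropy_mul_eq_sum_roots _ _ h1, entropy_mul_eq_sum_roots _ _ h2,
    Matrix.mul_assoc, hg, Matrix.mul_assoc]

end Entropy

/-! ### Schwarz inequality for channels and their adjoints -/

section Schwarz
variable {A B : Type*} [Fintype A] [Fintype B]

theorem IsChannel.posSemidef {N : Matrix A A ℂ →ₗ[ℂ] Matrix B B ℂ} (hN : IsChannel N)
    {X : Matrix A A ℂ} (hX : X.PosSemidef) : (N X).PosSemidef := by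
  have h := (hN.completelyPositive 1 _ (hX.submatrix Prod.fst)).submatrix fun b : B => (b, 0)
  exact h

theorem IsChannel.blocks_posSemidef {N : Matrix A A ℂ →ₗ[ℂ] Matrix B B ℂ} (hN : IsChannel N)
    {C : Type*} [Fintype C] {σ : Matrix C C ℂ} (hσ : σ.PosSemidef)
    {k : ℕ} (Z : Fin k → Matrix C A ℂ) :
    (Matrix.of fun x y : B × Fin k => N ((Z x.2)ᴴ * σ * Z y.2) x.1 y.1).PosSemidef := by
  let G : Matrix C (A × Fin k) ℂ := Matrix.of fun c x => Z x.2 c x.1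
  have h := hN.completelyPositive k _ (hσ.conjTranspose_mul_mul_same G)
  exact h

theorem IsChannel.map_conjTranspose [DecidableEq A] {N : Matrix A A ℂ →ₗ[ℂ] Matrix B B ℂ}
    (hN : IsChannel N) (X : Matrix A A ℂ) : N Xᴴ = (N X)ᴴ := by
  -- The off-diagonal blocks are N(X) and N(Xᴴ), and a positive block matrix is Hermitian.
  have h := (hN.blocks_posSemidef Matrix.PosSemidef.one (![1, X] : Fin 2 → Matrix A A ℂ)).1
  ext b b'
  have := h.apply (b, 1) (b', 0)
  simpa using this.symm

/-- The operator Schwarz inequality, in trace form, for the adjoint of a channel. -/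
theorem IsChannel.trace_adjoint_le [DecidableEq A] {N : Matrix A A ℂ →ₗ[ℂ] Matrix B B ℂ}
    (hN : IsChannel N) {σ : Matrix A A ℂ} (hσ : σ.PosSemidef) {X : Matrix A A ℂ}
    {Y : Matrix B B ℂ} (hXY : ∀ W, (Yᴴ * N W).trace = (Xᴴ * W).trace) :
    (Xᴴ * σ * X).trace.re ≤ (Yᴴ * N σ * Y).trace.re := by
  classical
  have h := hN.blocks_posSemidef hσ (![1, X] : Fin 2 → Matrix A A ℂ)
  -- Compress the block matrix by the column (Y, -1). After taking traces, adjointness turns both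
  -- cross terms into Tr(XᴴσX) in real part and trace preservation does so for the last block,
  -- leaving the claimed difference.
  let G : Matrix (B × Fin 2) B ℂ := Matrix.of fun x c => (![Y, -1] : Fin 2 → Matrix B B ℂ) x.2 x.1 c
  have h2 := (h.conjTranspose_mul_mul_same G).trace_nonneg
  have h3 : (Gᴴ * (Matrix.of fun x y : B × Fin 2 => N (((![1, X] : Fin 2 → Matrix A A ℂ) x.2)ᴴ
      * σ * (![1, X] : Fin 2 → Matrix A A ℂ) y.2) x.1 y.1) * G) =
      Yᴴ * N σ * Y - Yᴴ * N (σ * X) - N (Xᴴ * σ) * Y + N (Xᴴ * σ * X) := by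
    ext b b'
    simp only [G, Matrix.mul_apply, Matrix.conjTranspose_apply, Matrix.of_apply,
      Fintype.sum_prod_type, Fin.sum_univ_two, Matrix.sub_apply, Matrix.add_apply,
      Matrix.cons_val_zero, Matrix.cons_val_one, Matrix.conjTranspose_one, Matrix.one_mul,
      Matrix.mul_one, Finset.sum_add_distrib, Matrix.neg_apply, Matrix.one_apply]
    simp [add_mul, Finset.sum_add_distrib]
    ring
  have h4 : (N (Xᴴ * σ) * Y).trace = star (Yᴴ * N (σ * X)).trace := by
    rw [← Matrix.trace_conjTranspose, Matrix.conjTranspose_mul, ← hN.map_conjTranspose,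
      Matrix.conjTranspose_mul, hσ.1.eq, Matrix.conjTranspose_conjTranspose]
  rw [h3, Matrix.trace_add, Matrix.trace_sub, Matrix.trace_sub, h4, hXY, hN.tracePreserving,
    ← Matrix.mul_assoc] at h2
  have h5 := (Complex.le_def.1 h2).1
  simp at h5
  linarith

theorem exists_adjoint [DecidableEq A] (N : Matrix A A ℂ →ₗ[ℂ] Matrix B B ℂ) (Y : Matrix B B ℂ) :
    ∃ X : Matrix A A ℂ, ∀ W, (Yᴴ * N W).trace = (Xᴴ * W).trace := by
  refine ⟨Matrix.of fun a b => star (Yᴴ * N (Matrix.single a b 1)).trace, fun W => ?_⟩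
  conv_lhs => rw [Matrix.matrix_eq_sum_single W]
  simp only [map_sum, Matrix.mul_sum, Matrix.trace_sum]
  rw [Matrix.trace, Finset.sum_comm]
  refine Finset.sum_congr rfl fun b _ => ?_
  rw [Matrix.diag_apply, Matrix.mul_apply]
  refine Finset.sum_congr rfl fun a _ => ?_
  have : Matrix.single a b (W a b) = W a b • Matrix.single a b (1 : ℂ) := by simp
  rw [this, map_smul]
  simp [mul_comm]

theorem IsChannel.adjoint_conjTranspose [DecidableEq A] {N : Matrix A A ℂ →ₗ[ℂ] Matrix B B ℂ}
    (hN : IsChannel N) {X : Matrix A A ℂ} {Y : Matrix B B ℂ}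
    (hXY : ∀ W, (Yᴴ * N W).trace = (Xᴴ * W).trace) (W : Matrix A A ℂ) :
    (Yᴴᴴ * N W).trace = (Xᴴᴴ * W).trace := by
  have h := congrArg star (hXY Wᴴ)
  rw [← Matrix.trace_conjTranspose, ← Matrix.trace_conjTranspose, hN.map_conjTranspose,
    Matrix.conjTranspose_mul, Matrix.conjTranspose_mul, Matrix.trace_mul_comm,
    Matrix.trace_mul_comm _ Xᴴᴴ] at h
  simpa using h

end Schwarz

/-! ### Variational formula for the resolvent and its monotonicity -/

section QuadraticForm
variable {A : Type*} [Fintype A]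

/-- A concave quadratic form in `X`, whose maximum is `Tr (ρ (L_σ + t R_ρ)⁻¹ ρ)`. -/
noncomputable def quadForm (ρ σ : Matrix A A ℂ) (t : ℝ) (X : Matrix A A ℂ) : ℝ :=
  2 * (Xᴴ * ρ).trace.re - (Xᴴ * σ * X).trace.re - t * (X * ρ * Xᴴ).trace.re

/-- Pulling Y back by the adjoint preserves the linear term; Schwarz for Y and for Yᴴ shrinks the
two subtracted terms. -/
theorem IsChannel.exists_quadForm_le {B : Type*} [Fintype B] [DecidableEq A]
    {N : Matrix A A ℂ →ₗ[ℂ] Matrix B B ℂ} (hN : IsChannel N) {ρ σ : Matrix A A ℂ}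
    (hρ : ρ.PosSemidef) (hσ : σ.PosSemidef) {t : ℝ} (ht : 0 ≤ t) (Y : Matrix B B ℂ) :
    ∃ X, quadForm (N ρ) (N σ) t Y ≤ quadForm ρ σ t X := by
  obtain ⟨X, hX⟩ := exists_adjoint N Y
  refine ⟨X, ?_⟩
  have h1 := hN.trace_adjoint_le hσ hX
  have h2 := hN.trace_adjoint_le hρ (hN.adjoint_conjTranspose hX)
  rw [Matrix.conjTranspose_conjTranspose, Matrix.conjTranspose_conjTranspose] at h2
  have := mul_le_mul_of_nonneg_left h2 ht
  rw [quadForm, quadForm, hX]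
  linarith

variable [DecidableEq A]

/-- Squared overlaps of the eigenvectors of two Hermitian matrices. -/
noncomputable def overlap {ρ σ : Matrix A A ℂ} (hρ : ρ.IsHermitian) (hσ : σ.IsHermitian)
    (k j : A) : ℝ :=
  Complex.normSq (((hσ.eigenvectorUnitary : Matrix A A ℂ)ᴴ * hρ.eigenvectorUnitary) k j)

/-- The value of `Tr (ρ (L_σ + t R_ρ)⁻¹ ρ)` in eigenbases. -/
noncomputable def resolvent {ρ σ : Matrix A A ℂ} (hρ : ρ.IsHermitian) (hσ : σ.IsHermitian)
    (t : ℝ) : ℝ :=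
  ∑ k, ∑ j, overlap hρ hσ k j *
    (hρ.eigenvalues j ^ 2 / (hσ.eigenvalues k + t * hρ.eigenvalues j))

theorem eq_conj_diagonal {ρ : Matrix A A ℂ} (hρ : ρ.IsHermitian) :
    ρ = (hρ.eigenvectorUnitary : Matrix A A ℂ) * Matrix.diagonal (fun i => (hρ.eigenvalues i : ℂ)) *
      (hρ.eigenvectorUnitary : Matrix A A ℂ)ᴴ :=
  hρ.spectral_theorem

theorem unitary_conjTranspose_mul_self (U : Matrix.unitaryGroup A ℂ) :
    (U : Matrix A A ℂ)ᴴ * U = 1 := Unitary.coe_star_mul_self U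

theorem unitary_mul_conjTranspose_self (U : Matrix.unitaryGroup A ℂ) :
    (U : Matrix A A ℂ) * (U : Matrix A A ℂ)ᴴ = 1 := Unitary.coe_mul_star_self U

/-- In the two eigenbases the form decouples into one scalar quadratic per matrix entry. -/
theorem quadForm_conj {ρ σ : Matrix A A ℂ} (hρ : ρ.IsHermitian) (hσ : σ.IsHermitian) (t : ℝ)
    (X : Matrix A A ℂ) :
    quadForm ρ σ t (hσ.eigenvectorUnitary * X * (hρ.eigenvectorUnitary : Matrix A A ℂ)ᴴ) =
      ∑ k, ∑ j, (2 * (hρ.eigenvalues j * (star (X k j) *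
        ((hσ.eigenvectorUnitary : Matrix A A ℂ)ᴴ * hρ.eigenvectorUnitary) k j).re) -
        (hσ.eigenvalues k + t * hρ.eigenvalues j) * Complex.normSq (X k j)) := by
  set U := (hσ.eigenvectorUnitary : Matrix A A ℂ) with hU
  set V := (hρ.eigenvectorUnitary : Matrix A A ℂ) with hV
  have hUU : Uᴴ * U = 1 := unitary_conjTranspose_mul_self _
  have hVV : Vᴴ * V = 1 := unitary_conjTranspose_mul_self _
  set L := Matrix.diagonal (fun i => (hρ.eigenvalues i : ℂ)) with hL
  set M := Matrix.diagonal (fun i => (hσ.eigenvalues i : ℂ)) with hM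
  have eρ : ρ = V * L * Vᴴ := eq_conj_diagonal hρ
  have eσ : σ = U * M * Uᴴ := eq_conj_diagonal hσ
  have e1 : ((U * X * Vᴴ)ᴴ * ρ).trace = (Xᴴ * (Uᴴ * V) * L).trace := by
    have : (U * X * Vᴴ)ᴴ * ρ = V * (Xᴴ * (Uᴴ * V) * L * Vᴴ) := by
      rw [eρ]; simp [Matrix.mul_assoc]
    rw [this, Matrix.trace_mul_comm, Matrix.mul_assoc _ Vᴴ, hVV, Matrix.mul_one]
  have e2 : ((U * X * Vᴴ)ᴴ * σ * (U * X * Vᴴ)).trace = (Xᴴ * M * X).trace := by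
    have : (U * X * Vᴴ)ᴴ * σ * (U * X * Vᴴ) =
        V * (Xᴴ * (Uᴴ * U) * M * (Uᴴ * U) * X * Vᴴ) := by
      rw [eσ]; simp [Matrix.mul_assoc]
    rw [this, Matrix.trace_mul_comm, Matrix.mul_assoc _ Vᴴ, hVV, hUU]
    simp
  have e3 : ((U * X * Vᴴ) * ρ * (U * X * Vᴴ)ᴴ).trace = (X * L * Xᴴ).trace := by
    have : (U * X * Vᴴ) * ρ * (U * X * Vᴴ)ᴴ =
        U * (X * (Vᴴ * V) * L * (Vᴴ * V) * Xᴴ * Uᴴ) := by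
      rw [eρ]; simp [Matrix.mul_assoc]
    rw [this, Matrix.trace_mul_comm, Matrix.mul_assoc _ Uᴴ, hUU, hVV]
    simp
  rw [quadForm, e1, e2, e3]
  generalize Uᴴ * V = W
  have f1 : (Xᴴ * W * L).trace.re = ∑ k, ∑ j, hρ.eigenvalues j * (star (X k j) * W k j).re := by
    rw [Finset.sum_comm]
    simp only [hL, Matrix.trace, Matrix.diag_apply, Matrix.mul_diagonal, Matrix.mul_apply (M := Xᴴ),
      Matrix.conjTranspose_apply, Complex.re_sum]
    refine Finset.sum_congr rfl fun j _ => ?_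
    rw [mul_comm, Complex.re_ofReal_mul, Complex.re_sum, Finset.mul_sum]
  have f2 : (Xᴴ * M * X).trace.re = ∑ k, ∑ j, hσ.eigenvalues k * Complex.normSq (X k j) := by
    rw [Finset.sum_comm]
    simp only [hM, Matrix.trace, Matrix.diag_apply, Matrix.mul_diagonal, Matrix.mul_apply (N := X),
      Matrix.conjTranspose_apply, Complex.re_sum]
    refine Finset.sum_congr rfl fun j _ => Finset.sum_congr rfl fun k _ => ?_
    simp [Complex.normSq_apply]
    ring
  have f3 : (X * L * Xᴴ).trace.re = ∑ k, ∑ j, hρ.eigenvalues j * Complex.normSq (X k j) := by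
    simp only [hL, Matrix.trace, Matrix.diag_apply, Matrix.mul_diagonal, Matrix.mul_apply (N := Xᴴ),
      Matrix.conjTranspose_apply, Complex.re_sum]
    refine Finset.sum_congr rfl fun j _ => Finset.sum_congr rfl fun k _ => ?_
    simp [Complex.normSq_apply]
    ring
  rw [f1, f2, f3]
  simp only [Finset.mul_sum, ← Finset.sum_sub_distrib]
  refine Finset.sum_congr rfl fun j _ => Finset.sum_congr rfl fun k _ => ?_
  ring

theorem quadForm_le_resolvent {ρ σ : Matrix A A ℂ} (hρ : ρ.PosSemidef) (hσ : σ.PosSemidef)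
    {t : ℝ} (ht : 0 < t) (X : Matrix A A ℂ) : quadForm ρ σ t X ≤ resolvent hρ.1 hσ.1 t := by
  obtain ⟨X', rfl⟩ : ∃ X', X = hσ.1.eigenvectorUnitary * X' *
      (hρ.1.eigenvectorUnitary : Matrix A A ℂ)ᴴ := by
    refine ⟨(hσ.1.eigenvectorUnitary : Matrix A A ℂ)ᴴ * X * hρ.1.eigenvectorUnitary, ?_⟩
    simp only [← Matrix.mul_assoc, unitary_mul_conjTranspose_self, Matrix.one_mul]
    rw [Matrix.mul_assoc, unitary_mul_conjTranspose_self, Matrix.mul_one]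
  rw [quadForm_conj, resolvent]
  refine Finset.sum_le_sum fun k _ => Finset.sum_le_sum fun j _ => ?_
  rw [overlap]
  generalize ((hσ.1.eigenvectorUnitary : Matrix A A ℂ)ᴴ * hρ.1.eigenvectorUnitary) k j = w
  have hl := hρ.eigenvalues_nonneg j
  have hm := hσ.eigenvalues_nonneg k
  generalize hρ.1.eigenvalues j = l at *
  generalize hσ.1.eigenvalues k = m at *
  generalize X' k j = x
  rcases hl.eq_or_lt with rfl | hl
  · simpa using mul_nonneg hm (Complex.normSq_nonneg x)
  · have hc : 0 < m + t * l := by positivity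
    rw [← mul_div_assoc, le_div_iff₀ hc]
    simp only [Complex.normSq_apply, Complex.mul_re, Complex.star_def, Complex.conj_re,
      Complex.conj_im]
    generalize m + t * l = c at *
    -- Completing the square: 2l Re(x̄w) - c|x|² ≤ l²|w|²/c, with equality at x = lw/c.
    nlinarith [sq_nonneg (l * w.re - c * x.re), sq_nonneg (l * w.im - c * x.im)]

theorem exists_quadForm_eq_resolvent {ρ σ : Matrix A A ℂ} (hρ : ρ.PosSemidef)
    (hσ : σ.PosSemidef) {t : ℝ} (ht : 0 < t) : ∃ X, quadForm ρ σ t X = resolvent hρ.1 hσ.1 t := by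
  refine ⟨_, (quadForm_conj hρ.1 hσ.1 t (Matrix.of fun k j =>
    ((hρ.1.eigenvalues j / (hσ.1.eigenvalues k + t * hρ.1.eigenvalues j) : ℝ) : ℂ) *
    ((hσ.1.eigenvectorUnitary : Matrix A A ℂ)ᴴ * hρ.1.eigenvectorUnitary) k j)).trans ?_⟩
  rw [resolvent]
  refine Finset.sum_congr rfl fun k _ => Finset.sum_congr rfl fun j _ => ?_
  rw [overlap, Matrix.of_apply]
  generalize ((hσ.1.eigenvectorUnitary : Matrix A A ℂ)ᴴ * hρ.1.eigenvectorUnitary) k j = w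
  have hl := hρ.eigenvalues_nonneg j
  have hm := hσ.eigenvalues_nonneg k
  generalize hρ.1.eigenvalues j = l at *
  generalize hσ.1.eigenvalues k = m at *
  rcases hl.eq_or_lt with rfl | hl
  · simp
  · have hc : 0 < m + t * l := by positivity
    generalize m + t * l = c at *
    simp only [Complex.normSq_apply, Complex.mul_re, Complex.mul_im, Complex.star_def,
      Complex.conj_re, Complex.conj_im, Complex.ofReal_re, Complex.ofReal_im]
    field_simp
    ring

theorem IsChannel.resolvent_le {B : Type*} [Fintype B] [DecidableEq B]
    {N : Matrix A A ℂ →ₗ[ℂ] Matrix B B ℂ} (hN : IsChannel N) {ρ σ : Matrix A A ℂ}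
    (hρ : ρ.PosSemidef) (hσ : σ.PosSemidef) {t : ℝ} (ht : 0 < t) :
    resolvent (hN.posSemidef hρ).1 (hN.posSemidef hσ).1 t ≤ resolvent hρ.1 hσ.1 t := by
  obtain ⟨Y, hY⟩ := exists_quadForm_eq_resolvent (hN.posSemidef hρ) (hN.posSemidef hσ) ht
  obtain ⟨X, hX⟩ := hN.exists_quadForm_le hρ hσ ht.le Y
  exact hY ▸ hX.trans (quadForm_le_resolvent hρ hσ ht X)

end QuadraticForm

/-! ### Monotonicity of relative entropy -/

section RelativeEntropy
open Filter Topology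

variable {A : Type*} [Fintype A] [DecidableEq A]

theorem sum_normSq_col (W : Matrix A A ℂ) (hW : Wᴴ * W = 1) (j : A) :
    ∑ k, Complex.normSq (W k j) = 1 := by
  have h := congrFun (congrFun hW j) j
  simp only [Matrix.mul_apply, Matrix.conjTranspose_apply, Matrix.one_apply_eq] at h
  have h2 := congrArg Complex.re h
  simpa [Complex.normSq_apply] using h2

theorem sum_overlap_left {ρ σ : Matrix A A ℂ} (hρ : ρ.IsHermitian) (hσ : σ.IsHermitian) (j : A) :
    ∑ k, overlap hρ hσ k j = 1 := by
  refine sum_normSq_col _ ?_ j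
  rw [Matrix.conjTranspose_mul, Matrix.conjTranspose_conjTranspose, Matrix.mul_assoc,
    ← Matrix.mul_assoc (hσ.eigenvectorUnitary : Matrix A A ℂ), unitary_mul_conjTranspose_self,
    Matrix.one_mul, unitary_conjTranspose_mul_self]

theorem overlap_nonneg {ρ σ : Matrix A A ℂ} (hρ : ρ.IsHermitian) (hσ : σ.IsHermitian) (k j : A) :
    0 ≤ overlap hρ hσ k j := Complex.normSq_nonneg _

/-- Diagonal entries of `ρ` in the eigenbasis of `σ`. -/
noncomputable def diagIn {σ : Matrix A A ℂ} (hσ : σ.IsHermitian) (ρ : Matrix A A ℂ) (k : A) : ℝ :=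
  (((hσ.eigenvectorUnitary : Matrix A A ℂ)ᴴ * ρ * hσ.eigenvectorUnitary) k k).re

theorem diagIn_add_smul {σ : Matrix A A ℂ} (hσ : σ.IsHermitian) (a b : ℝ) (ρ τ : Matrix A A ℂ)
    (k : A) : diagIn hσ ((a : ℂ) • ρ + (b : ℂ) • τ) k = a * diagIn hσ ρ k + b * diagIn hσ τ k := by
  simp [diagIn, Matrix.mul_add, Matrix.add_mul]

theorem diagIn_nonneg {σ ρ : Matrix A A ℂ} (hσ : σ.IsHermitian) (hρ : ρ.PosSemidef) (k : A) :
    0 ≤ diagIn hσ ρ k :=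
  (Complex.le_def.1 (hρ.conjTranspose_mul_mul_same
    (hσ.eigenvectorUnitary : Matrix A A ℂ)).diag_nonneg).1

theorem diagIn_self {σ : Matrix A A ℂ} (hσ : σ.IsHermitian) (k : A) :
    diagIn hσ σ k = hσ.eigenvalues k := by
  rw [diagIn]
  have h : (hσ.eigenvectorUnitary : Matrix A A ℂ)ᴴ * σ * hσ.eigenvectorUnitary =
      Matrix.diagonal (fun i => (hσ.eigenvalues i : ℂ)) := by
    conv_lhs => enter [1, 2]; rw [eq_conj_diagonal hσ]
    simp only [← Matrix.mul_assoc, unitary_conjTranspose_mul_self, Matrix.one_mul]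
    rw [Matrix.mul_assoc, unitary_conjTranspose_mul_self, Matrix.mul_one]
  rw [h]
  simp

theorem diagIn_eq_sum_overlap {ρ σ : Matrix A A ℂ} (hρ : ρ.IsHermitian) (hσ : σ.IsHermitian)
    (k : A) : diagIn hσ ρ k = ∑ j, overlap hρ hσ k j * hρ.eigenvalues j := by
  rw [diagIn]
  have h : (hσ.eigenvectorUnitary : Matrix A A ℂ)ᴴ * ρ * (hσ.eigenvectorUnitary : Matrix A A ℂ) =
      ((hσ.eigenvectorUnitary : Matrix A A ℂ)ᴴ * (hρ.eigenvectorUnitary : Matrix A A ℂ)) *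
      Matrix.diagonal (fun i => (hρ.eigenvalues i : ℂ)) *
      ((hσ.eigenvectorUnitary : Matrix A A ℂ)ᴴ * (hρ.eigenvectorUnitary : Matrix A A ℂ))ᴴ := by
    conv_lhs => enter [1, 2]; rw [eq_conj_diagonal hρ]
    simp [Matrix.mul_assoc]
  rw [h]
  simp only [overlap]
  generalize (hσ.eigenvectorUnitary : Matrix A A ℂ)ᴴ * (hρ.eigenvectorUnitary : Matrix A A ℂ) = W
  rw [Matrix.mul_apply, Complex.re_sum]
  refine Finset.sum_congr rfl fun j _ => ?_
  simp [Complex.normSq_apply, Matrix.mul_diagonal]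
  ring

/-- `-Tr (ρ log σ)`. -/
noncomputable def crossEntropy {σ : Matrix A A ℂ} (hσ : σ.IsHermitian) (ρ : Matrix A A ℂ) : ℝ :=
  -∑ k, diagIn hσ ρ k * Real.log (hσ.eigenvalues k)

theorem crossEntropy_add_smul {σ : Matrix A A ℂ} (hσ : σ.IsHermitian) (a b : ℝ)
    (ρ τ : Matrix A A ℂ) : crossEntropy hσ ((a : ℂ) • ρ + (b : ℂ) • τ) =
      a * crossEntropy hσ ρ + b * crossEntropy hσ τ := by
  simp only [crossEntropy, diagIn_add_smul, mul_neg, Finset.mul_sum, ← neg_add, ←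
    Finset.sum_add_distrib]
  congr 1
  exact Finset.sum_congr rfl fun k _ => by ring

theorem crossEntropy_self {σ : Matrix A A ℂ} (hσ : σ.IsHermitian) :
    crossEntropy hσ σ = entropy σ := by
  rw [entropy, dif_pos hσ, crossEntropy, ← Finset.sum_neg_distrib]
  simp [diagIn_self, Real.negMulLog]

/-- An interpolation between `-Tr (ρ log σ)` and, up to a multiple of `log t`, `S(ρ)`. -/
noncomputable def logPotential {ρ σ : Matrix A A ℂ} (hρ : ρ.IsHermitian) (hσ : σ.IsHermitian)
    (t : ℝ) : ℝ :=
  ∑ k, ∑ j, overlap hρ hσ k j * hρ.eigenvalues j *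
    Real.log (hσ.eigenvalues k + t * hρ.eigenvalues j)

theorem logPotential_zero {ρ σ : Matrix A A ℂ} (hρ : ρ.IsHermitian) (hσ : σ.IsHermitian) :
    logPotential hρ hσ 0 = -crossEntropy hσ ρ := by
  simp [logPotential, crossEntropy, diagIn_eq_sum_overlap hρ hσ, Finset.sum_mul]

/-- Since σ ≥ cρ, the kernel of σ lies in that of ρ. This removes the terms whose logarithm would be
singular at t = 0, where `Real.log 0 = 0` would otherwise break continuity. -/
theorem overlap_mul_eq_zero {ρ σ : Matrix A A ℂ} (hρ : ρ.PosSemidef) (hσ : σ.IsHermitian)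
    {c : ℝ} (hc : 0 < c) (h : (σ - (c : ℂ) • ρ).PosSemidef) {k : A} (hk : hσ.eigenvalues k = 0)
    (j : A) : overlap hρ.1 hσ k j * hρ.1.eigenvalues j = 0 := by
  have h1 := diagIn_nonneg hσ h k
  have h2 := diagIn_add_smul hσ 1 (-c) σ ρ k
  have h3 := diagIn_nonneg hσ hρ k
  have e : ((1 : ℝ) : ℂ) • σ + ((-c : ℝ) : ℂ) • ρ = σ - (c : ℂ) • ρ := by
    simp [sub_eq_add_neg]
  rw [e, diagIn_self, hk] at h2
  have h4 : diagIn hσ ρ k = 0 := by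
    have : 0 ≤ -(c * diagIn hσ ρ k) := by linarith
    nlinarith
  rw [diagIn_eq_sum_overlap hρ.1 hσ] at h4
  exact (Finset.sum_eq_zero_iff_of_nonneg fun j _ =>
    mul_nonneg (overlap_nonneg _ _ _ _) (hρ.eigenvalues_nonneg j)).1 h4 j (Finset.mem_univ _)

theorem continuousOn_logPotential {ρ σ : Matrix A A ℂ} (hρ : ρ.PosSemidef) (hσ : σ.PosSemidef)
    {c : ℝ} (hc : 0 < c) (h : (σ - (c : ℂ) • ρ).PosSemidef) :
    ContinuousOn (logPotential hρ.1 hσ.1) (Set.Ici 0) := by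
  refine continuousOn_finsetSum _ fun k _ => continuousOn_finsetSum _ fun j _ => ?_
  rcases (hσ.eigenvalues_nonneg k).eq_or_lt with hk | hk
  · simpa [overlap_mul_eq_zero hρ hσ.1 hc h hk.symm j] using continuousOn_const
  · refine ContinuousOn.mul continuousOn_const (ContinuousOn.log (by fun_prop) fun t ht => ?_)
    have := mul_nonneg (Set.mem_Ici.1 ht) (hρ.eigenvalues_nonneg j)
    exact (add_pos_of_pos_of_nonneg hk this).ne'

theorem hasDerivAt_logPotential {ρ σ : Matrix A A ℂ} (hρ : ρ.PosSemidef) (hσ : σ.PosSemidef)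
    {t : ℝ} (ht : 0 < t) :
    HasDerivAt (logPotential hρ.1 hσ.1) (resolvent hρ.1 hσ.1 t) t := by
  refine HasDerivAt.fun_sum fun k _ => HasDerivAt.fun_sum fun j _ => ?_
  have hm := hσ.eigenvalues_nonneg k
  have hl := hρ.eigenvalues_nonneg j
  generalize hρ.1.eigenvalues j = l at *
  generalize hσ.1.eigenvalues k = m at *
  rcases hl.eq_or_lt with rfl | hl
  · simpa using hasDerivAt_const t (0 : ℝ)
  · have hpos : 0 < m + t * l := by positivity
    have h1 : HasDerivAt (fun t : ℝ => m + t * l) l t := by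
      simpa using ((hasDerivAt_id t).mul_const l).const_add m
    have h2 := (h1.log hpos.ne').const_mul (overlap hρ.1 hσ.1 k j * l)
    rwa [show overlap hρ.1 hσ.1 k j * l * (l / (m + t * l)) =
      overlap hρ.1 hσ.1 k j * (l ^ 2 / (m + t * l)) by ring] at h2

theorem sum_eigenvalues_eq_trace_re {ρ : Matrix A A ℂ} (hρ : ρ.IsHermitian) :
    ∑ j, hρ.eigenvalues j = ρ.trace.re := by
  rw [hρ.trace_eq_sum_eigenvalues]
  simp

theorem tendsto_logPotential {ρ σ : Matrix A A ℂ} (hρ : ρ.PosSemidef) (hσ : σ.PosSemidef) :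
    Tendsto (fun t => logPotential hρ.1 hσ.1 t - ρ.trace.re * Real.log t) atTop
      (𝓝 (-entropy ρ)) := by
  have e1 (f : A → ℝ) : ∑ k, ∑ j, overlap hρ.1 hσ.1 k j * hρ.1.eigenvalues j * f j =
      ∑ j, hρ.1.eigenvalues j * f j := by
    rw [Finset.sum_comm]
    refine Finset.sum_congr rfl fun j _ => ?_
    rw [← Finset.sum_mul, ← Finset.sum_mul, sum_overlap_left, one_mul]
  have e2 : -entropy ρ = ∑ k, ∑ j, overlap hρ.1 hσ.1 k j * hρ.1.eigenvalues j *
      Real.log (hρ.1.eigenvalues j) := by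
    rw [e1, entropy, dif_pos hρ.1, ← Finset.sum_neg_distrib]
    simp [Real.negMulLog]
  have e3 (t : ℝ) : logPotential hρ.1 hσ.1 t - ρ.trace.re * Real.log t =
      ∑ k, ∑ j, overlap hρ.1 hσ.1 k j * hρ.1.eigenvalues j *
      (Real.log (hσ.1.eigenvalues k + t * hρ.1.eigenvalues j) - Real.log t) := by
    simp only [mul_sub, Finset.sum_sub_distrib]
    rw [e1 fun _ => Real.log t, ← Finset.sum_mul, sum_eigenvalues_eq_trace_re]
    rfl
  simp only [e2, e3]
  refine tendsto_finsetSum _ fun k _ => tendsto_finsetSum _ fun j _ => ?_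
  have hm := hσ.eigenvalues_nonneg k
  have hl := hρ.eigenvalues_nonneg j
  generalize hρ.1.eigenvalues j = l at *
  generalize hσ.1.eigenvalues k = m at *
  rcases hl.eq_or_lt with rfl | hl
  · simp
  refine Tendsto.const_mul _ ?_
  -- For l > 0, log(m + tl) - log t = log(m/t + l), which tends to log l.
  have h1 : Tendsto (fun t : ℝ => m * t⁻¹ + l) atTop (𝓝 l) := by
    simpa using (tendsto_inv_atTop_zero.const_mul m).add_const l
  refine (h1.log hl.ne').congr' ?_
  filter_upwards [eventually_gt_atTop 0] with t ht
  have : 0 < m + t * l := by positivity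
  rw [← Real.log_div this.ne' ht.ne']
  congr 1
  field_simp

/-- Monotonicity of the relative entropy `-Tr (ρ log σ) - S(ρ)` under channels. -/
theorem IsChannel.crossEntropy_sub_entropy_le {B : Type*} [Fintype B] [DecidableEq B]
    {N : Matrix A A ℂ →ₗ[ℂ] Matrix B B ℂ} (hN : IsChannel N) {ρ σ : Matrix A A ℂ}
    (hρ : ρ.PosSemidef) (hσ : σ.PosSemidef) {c : ℝ} (hc : 0 < c)
    (h : (σ - (c : ℂ) • ρ).PosSemidef) :
    crossEntropy (hN.posSemidef hσ).1 (N ρ) - entropy (N ρ) ≤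
      crossEntropy hσ.1 ρ - entropy ρ := by
  have hρ' := hN.posSemidef hρ
  have hσ' := hN.posSemidef hσ
  have h' : (N σ - (c : ℂ) • N ρ).PosSemidef := by
    simpa only [map_sub, map_smul] using hN.posSemidef h
  have hd (t : ℝ) (ht : 0 < t) := (hasDerivAt_logPotential hρ hσ ht).sub
    (hasDerivAt_logPotential hρ' hσ' ht)
  have hmono : MonotoneOn (logPotential hρ.1 hσ.1 - logPotential hρ'.1 hσ'.1) (Set.Ici 0) := by
    refine monotoneOn_of_deriv_nonneg (convex_Ici 0) ((continuousOn_logPotential hρ hσ hc h).sub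
      (continuousOn_logPotential hρ' hσ' hc h')) ?_ ?_
    · rw [interior_Ici]
      exact fun t ht => (hd t ht).differentiableAt.differentiableWithinAt
    · rw [interior_Ici]
      intro t ht
      rw [(hd t ht).deriv]
      exact sub_nonneg.2 (hN.resolvent_le hρ hσ ht)
  have hlim := (tendsto_logPotential hρ hσ).sub (tendsto_logPotential hρ' hσ')
  -- The increasing difference of potentials is at least its value at 0; the log t corrections
  -- cancel by trace preservation.
  have hle := ge_of_tendsto hlim (b := -crossEntropy hσ.1 ρ - -crossEntropy hσ'.1 (N ρ)) (by
    filter_upwards [eventually_ge_atTop 0] with t ht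
    have := hmono (Set.mem_Ici.2 le_rfl) (Set.mem_Ici.2 ht) ht
    simp only [Pi.sub_apply, logPotential_zero] at this
    rw [hN.tracePreserving]
    linarith)
  linarith

/-- The Holevo quantity of a two-member ensemble does not increase under a channel. -/
theorem IsChannel.entropy_defect_le {B : Type*} [Fintype B] [DecidableEq B]
    {N : Matrix A A ℂ →ₗ[ℂ] Matrix B B ℂ} (hN : IsChannel N) {ρ τ : Matrix A A ℂ}
    (hρ : ρ.PosSemidef) (hτ : τ.PosSemidef) {a b : ℝ} (ha : 0 < a) (hb : 0 < b) :
    entropy (N ((a : ℂ) • ρ + (b : ℂ) • τ)) - (a * entropy (N ρ) + b * entropy (N τ)) ≤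
      entropy ((a : ℂ) • ρ + (b : ℂ) • τ) - (a * entropy ρ + b * entropy τ) := by
  have ha' : (0 : ℂ) ≤ a := by exact_mod_cast ha.le
  have hb' : (0 : ℂ) ≤ b := by exact_mod_cast hb.le
  have hσ := (hρ.smul ha').add (hτ.smul hb')
  -- For σ = aρ + bτ the domination constants are a and b, since σ - aρ = bτ and σ - bτ = aρ.
  have h1 := hN.crossEntropy_sub_entropy_le hρ hσ ha (by simpa using hτ.smul hb')
  have h2 := hN.crossEntropy_sub_entropy_le hτ hσ hb (by simpa using hρ.smul ha')
  have e1 := crossEntropy_add_smul hσ.1 a b ρ τ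
  have e2 := crossEntropy_add_smul (hN.posSemidef hσ).1 a b (N ρ) (N τ)
  rw [crossEntropy_self] at e1
  rw [← map_smul, ← map_smul, ← map_add, crossEntropy_self] at e2
  rw [e1, e2]
  have := mul_le_mul_of_nonneg_left h1 ha.le
  have := mul_le_mul_of_nonneg_left h2 hb.le
  linarith

end RelativeEntropy

/-! ### Concavity for degradable channels -/

theorem posSemidef_sum_smul {ι A : Type*} [Fintype ι] [Fintype A] {p : ι → ℝ} (hp : ∀ i, 0 ≤ p i)
    {ρ : ι → Matrix A A ℂ} (hρ : ∀ i, (ρ i).PosSemidef) : (∑ i, (p i : ℂ) • ρ i).PosSemidef :=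
  Matrix.posSemidef_sum _ fun i _ => (hρ i).smul (by exact_mod_cast hp i)

end QChannel

theorem theorem4 {ι A B E : Type*} [Fintype ι] [Fintype A] [DecidableEq A]
    [Fintype B] [DecidableEq B] [Fintype E] [DecidableEq E]
    (N : Matrix A A ℂ →ₗ[ℂ] Matrix B B ℂ) (Nc : Matrix A A ℂ →ₗ[ℂ] Matrix E E ℂ)
    (hN : QChannel.IsChannel N) (hNc : QChannel.IsComplementary N Nc)
    (hdeg : QChannel.IsDegradable N)
    (ρ : ι → Matrix A A ℂ) (hρ : ∀ i, QChannel.IsDensity (ρ i)) :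
    ConcaveOn ℝ (stdSimplex ℝ ι) (fun p => QChannel.privateHolevo N Nc p ρ) := by
  obtain ⟨k, M, D, hM, hD, rfl⟩ := hdeg
  -- Strictly positive weights suffice, and they serve as the domination constants in
  -- `IsChannel.entropy_defect_le`.
  refine concaveOn_iff_forall_pos.2 ⟨convex_stdSimplex ℝ ι, fun p hp q hq a b ha hb _ => ?_⟩
  have hP := QChannel.posSemidef_sum_smul hp.1 fun i => (hρ i).posSemidef
  have hQ := QChannel.posSemidef_sum_smul hq.1 fun i => (hρ i).posSemidef
  have ha' : (0 : ℂ) ≤ a := by exact_mod_cast ha.le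
  have hb' : (0 : ℂ) ≤ b := by exact_mod_cast hb.le
  have hR := (hP.smul ha').add (hQ.smul hb')
  have key := hD.entropy_defect_le (hN.posSemidef hP) (hN.posSemidef hQ) ha hb
  rw [← map_smul, ← map_smul, ← map_add] at key
  have e1 := hNc.entropy_eq hM hP.1
  have e2 := hNc.entropy_eq hM hQ.1
  have e3 := hNc.entropy_eq hM hR.1
  simp only [LinearMap.comp_apply] at e1 e2 e3
  rw [← e1, ← e2, ← e3] at key
  have hmix : ∑ i, (((a • p + b • q) i : ℝ) : ℂ) • ρ i =
      (a : ℂ) • ∑ i, (p i : ℂ) • ρ i + (b : ℂ) • ∑ i, (q i : ℂ) • ρ i := by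
    simp [Finset.smul_sum, ← Finset.sum_add_distrib, add_smul, mul_smul]
  have hlin (f : ι → ℝ) : ∑ i, (a • p + b • q) i * f i =
      a * ∑ i, p i * f i + b * ∑ i, q i * f i := by
    simp only [Finset.mul_sum, ← Finset.sum_add_distrib, Pi.add_apply, Pi.smul_apply, smul_eq_mul]
    exact Finset.sum_congr rfl fun i _ => by ring
  simp only [QChannel.privateHolevo, QChannel.holevo, ← map_smul, ← map_sum, hmix, hlin,
    smul_eq_mul]
  linarith
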